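/- Let $N\in\mathbb N$ and $R>0$. For $n\ge1$ let $(M_n^{sa})_R$ be the set of selfadjoint complex $n\times n$ matrices of operator norm at most $R$, let $\mathrm{tr}_n$ be the normalized trace, and let $\Lambda_n$ be the measure $2^{n(n-1)/2}\prod_i dA_{ii}\prod_{i<j}d(\mathrm{Re}\,A_{ij})\,d(\mathrm{Im}\,A_{ij})$ on the selfadjoint $n\times n$ matrices. Let $\mathbb C\langle X_1,\dots,X_N\rangle$ be the $*$-algebra of noncommutative polynomials with $X_i^*=X_i$, and let $\mathcal A=\mathcal A_R^{(N)}$ be its $C^*$-completion with respect to the norm $$\|p\|_R=\sup\{\|p(A_1,\dots,A_N)\|: n\ge1,\ A_1,\dots,A_N\in(M_n^{sa})_R\},$$ which is the $N$-fold full free product $C([-R,R])^{\star N}$. For $A_1,\dots,A_N\in(M_n^{sa})_R$ let $h\mapsto h(A_1,\dots,A_N)$ be the $*$-homomorphism $\mathcal A\to M_n(\mathbb C)$ extending the evaluation of polynomials. For selfadjoint $h\in\mathcal A$ let $$\pi_R(h)=\limsup_{n\to\infty}\Bigl(\frac1{n^2}\log\int_{(M_n^{sa})_R^N}\exp\bigl(-n^2\,\mathrm{tr}_n(h(A_1,\dots,A_N))\bigr)\,d\Lambda_n^{\otimes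 N}(A_1,\dots,A_N)+\frac N2\log n\Bigr)$$ (the free pressure), and for a tracial state $\mu$ on $\mathcal A$ let $$\eta_R(\mu)=\inf\{\mu(p)+\pi_R(p): p\in\mathbb C\langle X_1,\dots,X_N\rangle,\ p=p^*\}.$$ These quantities are understood in $[-\infty,+\infty]$. Let $\mathcal T(\mathcal A)$ be the set of tracial states on $\mathcal A$, with the weak* topology. Then: (1) For every $\mu\in\mathcal T(\mathcal A)$, $$\eta_R(\mu)=\inf\{\mu(h)+\pi_R(h): h\in\mathcal A,\ h=h^*\},$$ and $\eta_R$ is concave and weak* upper semicontinuous on the convex set $\mathcal T(\mathcal A)$. (2) For every selfadjoint $h\in\mathcal A$, $$\pi_R(h)=\sup\{-\mu(h)+\eta_R(\mu):\mu\in\mathcal T(\mathcal A)\}.$$ -/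

import Mathlib

open MeasureTheory Filter
open scoped ENNReal Matrix.Norms.L2Operator ComplexOrder

noncomputable section

namespace FreePressure

/-! ### Hermitian matrices and the measure `Λ_n` -/

/-- The real space of selfadjoint complex `n × n` matrices. Matrices carry the operator norm
of `ℂⁿ` (the `L2Operator` norm). -/
abbrev HermMat (n : ℕ) : Type := selfAdjoint (Matrix (Fin n) (Fin n) ℂ)

/-- The Borel σ-algebra on the selfadjoint matrices. -/
instance instMeasurableSpaceHermMat (n : ℕ) : MeasurableSpace (HermMat n) := borel _

instance instBorelSpaceHermMat (n : ℕ) : BorelSpace (HermMat n) := ⟨rfl⟩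

/-- The selfadjoint matrix `A` with real coordinates `x`: `A i i = x i i`, and, for `i < j`,
`Re (A i j) = x i j`, `Im (A i j) = x j i`. -/
def hermOfCoords (n : ℕ) (x : Fin n → Fin n → ℝ) : HermMat n :=
  ⟨Matrix.of fun i j =>
      if i = j then (x i i : ℂ)
      else if i < j then (x i j : ℂ) + (x j i : ℂ) * Complex.I
      else (x j i : ℂ) - (x i j : ℂ) * Complex.I, by
    rw [selfAdjoint.mem_iff]
    ext i j
    rw [Matrix.star_apply, Matrix.of_apply, Matrix.of_apply]
    rcases lt_trichotomy i j with h | h | h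
    · simp [h, h.ne, h.ne', h.not_gt]
    · simp [h]
    · simp [h, h.ne, h.ne', h.not_gt, sub_eq_add_neg]⟩

theorem continuous_hermOfCoords (n : ℕ) : Continuous (hermOfCoords n) := by
  refine Continuous.subtype_mk (continuous_matrix fun i j => ?_) _
  simp only [Matrix.of_apply]
  split_ifs <;> fun_prop

/-- The "Lebesgue" measure `Λ_n` on the selfadjoint matrices:
`dΛ_n(A) = 2^{n(n-1)/2} ∏ dA_{ii} ∏_{i<j} d(Re A_{ij}) d(Im A_{ij})`. -/
def lebesgueHerm (n : ℕ) : Measure (HermMat n) :=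
  ENNReal.ofReal ((2 : ℝ) ^ ((n : ℝ) * ((n : ℝ) - 1) / 2)) •
    Measure.map (hermOfCoords n) volume

/-- `(M_n^{sa})_R^N`: the `N`-tuples of selfadjoint `n × n` matrices of operator norm at
most `R`. -/
abbrev MatBall (N : ℕ) (R : ℝ) (n : ℕ) : Type :=
  {A : Fin N → HermMat n // ∀ i, ‖(A i : Matrix (Fin n) (Fin n) ℂ)‖ ≤ R}

/-- The restriction of the `N`-fold product measure `Λ_n^{⊗N}` to `(M_n^{sa})_R^N`. -/
def ballMeasure (N : ℕ) (R : ℝ) (n : ℕ) : Measure (MatBall N R n) :=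
  Measure.comap Subtype.val (Measure.pi fun _ : Fin N => lebesgueHerm n)

/-- The (real part of the) normalized trace `tr_n`; it is real on selfadjoint matrices. -/
def normTr (n : ℕ) (A : Matrix (Fin n) (Fin n) ℂ) : ℝ := (A.trace).re / n

/-! ### Noncommutative polynomials -/

/-- The algebra `ℂ⟨X_1,…,X_N⟩` of polynomials in `N` noncommuting indeterminates: the monoid
algebra of the free monoid of words in the indeterminates. -/
abbrev NCPoly (N : ℕ) : Type := MonoidAlgebra ℂ (FreeMonoid (Fin N))

/-- The involution of `ℂ⟨X_1,…,X_N⟩` with `X_i^* = X_i`: it conjugates the coefficients and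
reverses the words (`star w` is the reversed word). -/
def polyStar {N : ℕ} (p : NCPoly N) : NCPoly N :=
  p.coeff.sum fun w c => MonoidAlgebra.single (star w) (star c)

/-- `ℂ⟨X_1,…,X_N⟩^{sa}`. -/
def saPoly (N : ℕ) : Set (NCPoly N) := {p | polyStar p = p}

/-! ### The C*-algebra `A_R^{(N)}` -/

/-- The index set of all matrix evaluations: a size `n ≥ 1` and an `N`-tuple in
`(M_n^{sa})_R^N`. -/
abbrev EvalIndex (N : ℕ) (R : ℝ) : Type := Σ n : ℕ+, MatBall N R n

/-- The matrix algebra in which the evaluation at the index `k` takes its values. -/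
abbrev EvalFiber (N : ℕ) (R : ℝ) (k : EvalIndex N R) : Type :=
  Matrix (Fin (k.1 : ℕ)) (Fin (k.1 : ℕ)) ℂ

instance instNormOneClassMatrix (n : ℕ+) :
    NormOneClass (Matrix (Fin (n : ℕ)) (Fin (n : ℕ)) ℂ) :=
  haveI : Nonempty (Fin (n : ℕ)) := ⟨⟨0, n.pos⟩⟩
  inferInstance

/-- The C*-algebra of all bounded families of matrices, indexed by the matrix evaluations, with
the supremum of the operator norms. -/
abbrev BoundedFamilies (N : ℕ) (R : ℝ) : Type := lp (EvalFiber N R) ∞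

/-- The bounded family `(n, A) ↦ A_i`. -/
def coordFamily (N : ℕ) (R : ℝ) (i : Fin N) : BoundedFamilies N R :=
  ⟨fun k => (k.2.1 i : Matrix (Fin (k.1 : ℕ)) (Fin (k.1 : ℕ)) ℂ),
    memℓp_infty ⟨R, by rintro _ ⟨k, rfl⟩; exact k.2.2 i⟩⟩

/-- `A_R^{(N)}`: the C*-completion of `ℂ⟨X_1,…,X_N⟩` with respect to the norm
`‖p‖_R = sup {‖p(A_1,…,A_N)‖ : n ≥ 1, (A_1,…,A_N) ∈ (M_n^{sa})_R^N}` (which is the `N`-fold full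
free product of `C([-R,R])`). A polynomial `p` is identified with the bounded family
`(n, A) ↦ p(A)`, whose supremum norm is `‖p‖_R`, and the completion is realized as the norm closure
of the polynomials in the C*-algebra of bounded families, that is, as the closure of the
`*`-subalgebra generated by the families `X_i`. -/
def freeProd (N : ℕ) (R : ℝ) : StarSubalgebra ℂ (BoundedFamilies N R) :=
  (StarAlgebra.adjoin ℂ (Set.range (coordFamily N R))).topologicalClosure

/-- `A_R^{(N)}` as a type. -/
def FreeProd (N : ℕ) (R : ℝ) : Type := freeProd N R

/-- The norm and the ring operations are those of the bounded families of matrices. -/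
instance instNormedRingFreeProd (N : ℕ) (R : ℝ) : NormedRing (FreeProd N R) :=
  inferInstanceAs (NormedRing (freeProd N R))

instance instNormedAlgebraFreeProd (N : ℕ) (R : ℝ) : NormedAlgebra ℂ (FreeProd N R) :=
  inferInstanceAs (NormedAlgebra ℂ (freeProd N R))

instance instStarRingFreeProd (N : ℕ) (R : ℝ) : StarRing (FreeProd N R) :=
  inferInstanceAs (StarRing (freeProd N R))

instance instCStarRingFreeProd (N : ℕ) (R : ℝ) : CStarRing (FreeProd N R) :=
  inferInstanceAs (CStarRing (freeProd N R))

instance instStarModuleFreeProd (N : ℕ) (R : ℝ) : StarModule ℂ (FreeProd N R) :=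
  inferInstanceAs (StarModule ℂ (freeProd N R))

instance instCompleteSpaceFreeProd (N : ℕ) (R : ℝ) : CompleteSpace (FreeProd N R) :=
  inferInstanceAs (CompleteSpace
    ((StarAlgebra.adjoin ℂ (Set.range (coordFamily N R))).topologicalClosure))

instance instCStarAlgebraFreeProd (N : ℕ) (R : ℝ) : CStarAlgebra (FreeProd N R) where

/-- The canonical generators `X_i` of `A_R^{(N)}`. -/
def gen (N : ℕ) (R : ℝ) (i : Fin N) : FreeProd N R :=
  (⟨coordFamily N R i, (StarSubalgebra.le_topologicalClosure _)
    (StarAlgebra.subset_adjoin ℂ _ ⟨i, rfl⟩)⟩ : freeProd N R)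

/-- The canonical homomorphism `ℂ⟨X_1,…,X_N⟩ → A_R^{(N)}`. -/
def ofPoly (N : ℕ) (R : ℝ) : NCPoly N →ₐ[ℂ] FreeProd N R :=
  MonoidAlgebra.lift ℂ (FreeProd N R) (FreeMonoid (Fin N)) (FreeMonoid.lift (gen N R))

/-- The functional calculus `h ↦ h(A_1,…,A_N)` at matrices `(A_1,…,A_N) ∈ (M_n^{sa})_R^N`: the
`*`-homomorphism `A_R^{(N)} → M_n` with `X_i ↦ A_i`, which is the projection of a bounded family
onto its component at `(n, A)`. -/
def evalAt {N : ℕ} {R : ℝ} (n : ℕ+) (A : MatBall N R n) (h : FreeProd N R) :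
    Matrix (Fin (n : ℕ)) (Fin (n : ℕ)) ℂ :=
  (Subtype.val (p := (· ∈ freeProd N R)) h).1 ⟨n, A⟩

/-! ### Free pressure and its Legendre transform -/

/-- The free pressure
`π_R(h) = limsup_n (n⁻² log ∫ exp(-n² tr_n(h(A))) dΛ_n^{⊗N}(A) + (N/2) log n)` of a selfadjoint
`h ∈ A_R^{(N)}`, the integral being over `(M_n^{sa})_R^N`. The (positive) integral, its logarithm
and the upper limit are taken in the extended reals. -/
def freePressure {N : ℕ} {R : ℝ} (h : FreeProd N R) : EReal :=
  limsup (fun n : ℕ+ =>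
    ((1 / (n : ℝ) ^ 2 : ℝ) : EReal) *
        ENNReal.log (∫⁻ A : MatBall N R n,
          ENNReal.ofReal (Real.exp (-((n : ℝ) ^ 2 * normTr n (evalAt n A h)))) ∂ballMeasure N R n)
      + (((N : ℝ) / 2 * Real.log (n : ℝ) : ℝ) : EReal)) atTop

/-- `η_R(μ) = inf {μ(p) + π_R(p) : p ∈ ℂ⟨X_1,…,X_N⟩^{sa}}` for a linear functional `μ` on
`ℂ⟨X_1,…,X_N⟩`; for a selfadjoint functional, `μ(p)` is real for selfadjoint `p`. -/
def etaPoly {N : ℕ} (R : ℝ) (μ : NCPoly N →ₗ[ℂ] ℂ) : EReal :=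
  ⨅ p ∈ saPoly N, (((μ p).re : ℝ) : EReal) + freePressure (ofPoly N R p)

/-- The restriction of a continuous functional on `A_R^{(N)}` to `ℂ⟨X_1,…,X_N⟩`. -/
def restrictPoly {N : ℕ} {R : ℝ} (μ : WeakDual ℂ (FreeProd N R)) : NCPoly N →ₗ[ℂ] ℂ :=
  (WeakDual.toStrongDual μ).toLinearMap ∘ₗ (ofPoly N R).toLinearMap

/-- `η_R(μ)` for a continuous functional `μ` on `A_R^{(N)}`: the value of `η_R` at the restriction
of `μ` to the polynomials. -/
def eta {N : ℕ} {R : ℝ} (μ : WeakDual ℂ (FreeProd N R)) : EReal :=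
  etaPoly R (restrictPoly μ)

/-- The set of tracial states of `A_R^{(N)}`, inside the dual space with its weak* topology.
The inequality means that the value is a nonnegative real number. -/
def tracialStates (N : ℕ) (R : ℝ) : Set (WeakDual ℂ (FreeProd N R)) :=
  {μ | μ 1 = 1 ∧ (∀ a, 0 ≤ μ (star a * a)) ∧ ∀ a b, μ (a * b) = μ (b * a)}

end FreePressure

end

/-! The theorem is Fenchel duality for `freePressure`. Evaluations and normalized traces are
contractive, so the pressure is 1-Lipschitz (`freePressure_le_add_norm`); hence it is identically
`⊥`, identically `⊤`, or real-valued (`freePressure_trichotomy`). In the last case Hölder's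
inequality makes it convex (`freePressure_convex`).

Since selfadjoint polynomials are dense in the selfadjoint part, the Lipschitz bound lets the
infimum defining `eta` run over all selfadjoint elements (`eta_le`). As an infimum of weak*
continuous affine functions of `μ`, `eta` is concave and upper semicontinuous.

For part (2), `≥` is Fenchel's inequality. For `≤`, Hahn–Banach gives, for each real `b` below the
pressure at `h`, a continuous affine minorant `Re l + c` with value `b` at `h`; then `eta (-l) ≥ c`.
That `-l` is a tracial state (`neg_mem_tracialStates_of_le`) follows from monotonicity of the
pressure in the traces. The pressure is defined on the whole algebra through real parts of traces,
so the duality runs there, with no restriction to selfadjoint elements. -/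

namespace FreePressure

/-! ### Polynomials in the C*-algebra -/

section Polynomials

variable {N : ℕ}

theorem polyStar_single (w : FreeMonoid (Fin N)) (c : ℂ) :
    polyStar (MonoidAlgebra.single w c : NCPoly N) = MonoidAlgebra.single (star w) (star c) := by
  simp [polyStar]

theorem polyStar_add (p q : NCPoly N) : polyStar (p + q) = polyStar p + polyStar q := by
  unfold polyStar
  rw [MonoidAlgebra.coeff_add]
  exact Finsupp.sum_add_index' (by simp) (by simp [MonoidAlgebra.single_add])

theorem polyStar_zero : polyStar (0 : NCPoly N) = 0 := by
  simp [polyStar]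

theorem polyStar_polyStar (p : NCPoly N) : polyStar (polyStar p) = p := by
  induction p using MonoidAlgebra.induction_linear with
  | zero => simp [polyStar_zero]
  | add p q hp hq => rw [polyStar_add, polyStar_add, hp, hq]
  | single w c => simp [polyStar_single]

theorem star_gen (R : ℝ) (i : Fin N) : star (gen N R i) = gen N R i := by
  apply Subtype.ext
  apply Subtype.ext
  funext k
  exact (k.2.1 i).2

theorem lift_gen_star (R : ℝ) (w : FreeMonoid (Fin N)) :
    FreeMonoid.lift (gen N R) (star w) = star (FreeMonoid.lift (gen N R) w) := by
  induction w using FreeMonoid.inductionOn' with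
  | one => simp
  | of_mul i w hw => simp [hw, star_gen]

theorem ofPoly_polyStar (R : ℝ) (p : NCPoly N) :
    ofPoly N R (polyStar p) = star (ofPoly N R p) := by
  induction p using MonoidAlgebra.induction_linear with
  | zero => simp [polyStar_zero]
  | add p q hp hq => rw [polyStar_add, map_add, map_add, star_add, hp, hq]
  | single w c => simp [polyStar_single, ofPoly, lift_gen_star]

/-- The generators are selfadjoint and `polyStar` implements the involution, so the polynomials
already exhaust the star subalgebra whose closure is `freeProd`. -/
theorem denseRange_ofPoly (N : ℕ) (R : ℝ) : DenseRange (ofPoly N R) := by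
  have key : ∀ x ∈ StarAlgebra.adjoin ℂ (Set.range (coordFamily N R)),
      ∃ p, (Subtype.val (p := (· ∈ freeProd N R)) (ofPoly N R p)) = x := by
    intro x hx
    induction hx using StarAlgebra.adjoin_induction with
    | mem x hx =>
      obtain ⟨i, rfl⟩ := hx
      refine ⟨MonoidAlgebra.of ℂ _ (FreeMonoid.of i), ?_⟩
      have hp : ofPoly N R (MonoidAlgebra.of ℂ _ (FreeMonoid.of i)) = gen N R i := by
        simp [ofPoly]
      rw [hp]
      rfl
    | algebraMap c =>
      refine ⟨algebraMap ℂ _ c, ?_⟩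
      rw [AlgHom.commutes]
      rfl
    | add x y _ _ hx hy =>
      obtain ⟨p, rfl⟩ := hx
      obtain ⟨q, rfl⟩ := hy
      exact ⟨p + q, by rw [map_add]; rfl⟩
    | mul x y _ _ hx hy =>
      obtain ⟨p, rfl⟩ := hx
      obtain ⟨q, rfl⟩ := hy
      exact ⟨p * q, by rw [map_mul]; rfl⟩
    | star x _ hx =>
      obtain ⟨p, rfl⟩ := hx
      exact ⟨polyStar p, by rw [ofPoly_polyStar]; rfl⟩
  intro x
  refine (closure_subtype (p := (· ∈ freeProd N R)) (x := x)).2 ?_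
  have hx : (Subtype.val (p := (· ∈ freeProd N R)) x) ∈
      closure (StarAlgebra.adjoin ℂ (Set.range (coordFamily N R)) : Set (BoundedFamilies N R)) :=
    Subtype.property (p := (· ∈ freeProd N R)) x
  refine closure_mono ?_ hx
  intro y hy
  obtain ⟨p, rfl⟩ := key y hy
  exact ⟨_, ⟨p, rfl⟩, rfl⟩

/-- Selfadjoint polynomials are dense among the selfadjoint elements. -/
theorem mem_closure_ofPoly_saPoly {R : ℝ} {h : FreeProd N R} (hh : star h = h) :
    h ∈ closure (ofPoly N R '' saPoly N) := by
  -- Taking selfadjoint parts is continuous, fixes `h`, and maps polynomials to selfadjoint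
  -- polynomials.
  have hcont : Continuous fun x : FreeProd N R => (1 / 2 : ℂ) • x + star ((1 / 2 : ℂ) • x) := by
    fun_prop
  have := map_mem_closure (t := ofPoly N R '' saPoly N) hcont (denseRange_ofPoly N R h) ?_
  · have e : (1 / 2 : ℂ) • h + star ((1 / 2 : ℂ) • h) = h := by
      rw [star_smul, hh, ← add_smul]
      norm_num
    rwa [e] at this
  · rintro _ ⟨p, rfl⟩
    refine ⟨(1 / 2 : ℂ) • p + polyStar ((1 / 2 : ℂ) • p), ?_, ?_⟩
    · change polyStar _ = _
      rw [polyStar_add, polyStar_polyStar, add_comm]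
    · rw [map_add, ofPoly_polyStar, map_smul]

end Polynomials

/-! ### The normalized trace of an evaluation -/

section Evaluation

variable {N : ℕ} {R : ℝ} (n : ℕ+) (A : MatBall N R n)

theorem evalAt_add (h k : FreeProd N R) : evalAt n A (h + k) = evalAt n A h + evalAt n A k := rfl

theorem evalAt_sub (h k : FreeProd N R) : evalAt n A (h - k) = evalAt n A h - evalAt n A k := rfl

theorem evalAt_mul (h k : FreeProd N R) : evalAt n A (h * k) = evalAt n A h * evalAt n A k := rfl

theorem evalAt_smul (c : ℂ) (h : FreeProd N R) : evalAt n A (c • h) = c • evalAt n A h := rfl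

theorem evalAt_neg (h : FreeProd N R) : evalAt n A (-h) = -evalAt n A h := rfl

theorem evalAt_one : evalAt n A (1 : FreeProd N R) = 1 := rfl

theorem evalAt_gen (i : Fin N) :
    evalAt n A (gen N R i) = (A.1 i : Matrix (Fin (n : ℕ)) (Fin (n : ℕ)) ℂ) := rfl

theorem norm_evalAt_le (h : FreeProd N R) : ‖evalAt n A h‖ ≤ ‖h‖ :=
  lp.norm_apply_le_norm ENNReal.top_ne_zero (Subtype.val (p := (· ∈ freeProd N R)) h) ⟨n, A⟩

theorem normTr_add (n : ℕ) (M M' : Matrix (Fin n) (Fin n) ℂ) :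
    normTr n (M + M') = normTr n M + normTr n M' := by
  simp [normTr, add_div]

theorem normTr_sub (n : ℕ) (M M' : Matrix (Fin n) (Fin n) ℂ) :
    normTr n (M - M') = normTr n M - normTr n M' := by
  simp [normTr, sub_div]

theorem normTr_ofReal_smul (n : ℕ) (c : ℝ) (M : Matrix (Fin n) (Fin n) ℂ) :
    normTr n ((c : ℂ) • M) = c * normTr n M := by
  simp [normTr, mul_div_assoc]

theorem norm_entry_le_norm {m : Type*} [Fintype m] [DecidableEq m] (M : Matrix m m ℂ) (i j : m) :
    ‖M i j‖ ≤ ‖M‖ := by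
  have h := M.l2_opNorm_mulVec (EuclideanSpace.single j (1 : ℂ))
  rw [PiLp.norm_single, norm_one, mul_one] at h
  refine le_trans ?_ h
  have h2 := PiLp.norm_apply_le ((EuclideanSpace.equiv m ℂ).symm
    (M.mulVec (EuclideanSpace.single j (1 : ℂ)))) i
  simpa using h2

theorem abs_normTr_le (n : ℕ+) (M : Matrix (Fin (n : ℕ)) (Fin (n : ℕ)) ℂ) :
    |normTr n M| ≤ ‖M‖ := by
  have hn : (0 : ℝ) < (n : ℕ) := by exact_mod_cast n.pos
  rw [normTr, abs_div, abs_of_pos hn, div_le_iff₀ hn]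
  calc |M.trace.re| ≤ ‖M.trace‖ := Complex.abs_re_le_norm _
    _ ≤ ∑ i, ‖M i i‖ := norm_sum_le _ _
    _ ≤ ∑ _i : Fin (n : ℕ), ‖M‖ := Finset.sum_le_sum fun i _ => norm_entry_le_norm M i i
    _ = ‖M‖ * (n : ℕ) := by simp [mul_comm]

theorem normTr_one (n : ℕ+) : normTr n (1 : Matrix (Fin (n : ℕ)) (Fin (n : ℕ)) ℂ) = 1 := by
  simp [normTr]

/-- Polynomial evaluations are continuous, and contractivity makes the evaluation of `h` a uniform
limit of them. This supplies the measurability needed for Hölder's inequality. -/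
theorem continuous_evalAt (h : FreeProd N R) : Continuous fun A : MatBall N R n => evalAt n A h := by
  have hpoly (p : NCPoly N) : Continuous fun A : MatBall N R n => evalAt n A (ofPoly N R p) := by
    induction p using MonoidAlgebra.induction_on with
    | of w =>
      have : ofPoly N R (MonoidAlgebra.of ℂ _ w) = FreeMonoid.lift (gen N R) w := by
        simp [ofPoly]
      rw [this]
      clear this
      induction w using FreeMonoid.inductionOn' with
      | one => simpa [evalAt_one] using continuous_const
      | of_mul i w hw =>
        simp only [map_mul, FreeMonoid.lift_eval_of, evalAt_mul, evalAt_gen]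
        exact (continuous_subtype_val.comp
          ((continuous_apply i).comp continuous_subtype_val)).mul hw
    | add p q hp hq =>
      simp only [map_add, evalAt_add]
      exact hp.add hq
    | smul c p hp =>
      simp only [map_smul, evalAt_smul]
      exact hp.const_smul c
  refine continuous_of_uniform_approx_of_continuous fun u hu => ?_
  obtain ⟨ε, hε, hεu⟩ := Metric.mem_uniformity_dist.1 hu
  obtain ⟨p, hp⟩ := (denseRange_ofPoly N R).exists_dist_lt h hε
  refine ⟨_, hpoly p, fun A => hεu ?_⟩
  rw [dist_eq_norm] at hp ⊢
  rw [← evalAt_sub]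
  exact (norm_evalAt_le n A _).trans_lt hp

theorem measurable_normTr_evalAt (h : FreeProd N R) :
    Measurable fun A : MatBall N R n => normTr n (evalAt n A h) := by
  have : Continuous fun A : MatBall N R n => normTr n (evalAt n A h) := by
    unfold normTr
    exact (Complex.continuous_re.comp (continuous_evalAt n h).matrix_trace).div_const _
  exact this.measurable

end Evaluation

/-! ### Elementary properties of the free pressure -/

section Pressure

variable {N : ℕ} {R : ℝ}

/-- The integrands compare pointwise up to the constant factor `exp (n² c)`, which leaves the
integral. -/
theorem log_lintegral_exp_le (n : ℕ+) {h k : FreeProd N R} {c : ℝ}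
    (H : ∀ A : MatBall N R n, normTr n (evalAt n A h) ≤ normTr n (evalAt n A k) + c) :
    ENNReal.log (∫⁻ A : MatBall N R n,
        ENNReal.ofReal (Real.exp (-((n : ℝ) ^ 2 * normTr n (evalAt n A k)))) ∂ballMeasure N R n) ≤
      (((n : ℝ) ^ 2 * c : ℝ) : EReal) + ENNReal.log (∫⁻ A : MatBall N R n,
        ENNReal.ofReal (Real.exp (-((n : ℝ) ^ 2 * normTr n (evalAt n A h)))) ∂ballMeasure N R n) := by
  have hlog : (((n : ℝ) ^ 2 * c : ℝ) : EReal) =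
      ENNReal.log (ENNReal.ofReal (Real.exp ((n : ℝ) ^ 2 * c))) := by
    rw [ENNReal.log_ofReal_of_pos (Real.exp_pos _), Real.log_exp]
  rw [hlog, ← ENNReal.log_mul_add, ← lintegral_const_mul' _ _ ENNReal.ofReal_ne_top]
  refine ENNReal.log_monotone (lintegral_mono fun A => ?_)
  rw [← ENNReal.ofReal_mul (Real.exp_pos _).le, ← Real.exp_add]
  refine ENNReal.ofReal_le_ofReal (Real.exp_le_exp.2 ?_)
  have := mul_le_mul_of_nonneg_left (H A) (sq_nonneg (n : ℝ))
  linarith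

/-- The free pressure is decreasing in the traces of the evaluations, and it is shifted by
additive constants. -/
theorem freePressure_le {h k : FreeProd N R} {c : ℝ}
    (H : ∀ (n : ℕ+) (A : MatBall N R n),
      normTr n (evalAt n A h) ≤ normTr n (evalAt n A k) + c) :
    freePressure k ≤ freePressure h + c := by
  have hlim : limsup (fun _ : ℕ+ => (c : EReal)) atTop = c := limsup_const _
  unfold freePressure
  conv_rhs => rw [← hlim]
  refine le_trans (limsup_le_limsup (Eventually.of_forall fun n => ?_))
    (EReal.limsup_add_le (.inr (by simp [hlim])) (.inr (by simp [hlim])))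
  have hn : (0 : ℝ) < (n : ℕ) := by exact_mod_cast n.pos
  have hn2 : (0 : EReal) ≤ ((1 / (n : ℝ) ^ 2 : ℝ) : EReal) := by
    exact_mod_cast (by positivity : (0 : ℝ) ≤ 1 / (n : ℝ) ^ 2)
  have h1 := mul_le_mul_of_nonneg_left (log_lintegral_exp_le n (H n)) hn2
  rw [EReal.left_distrib_of_nonneg_of_ne_top hn2 (EReal.coe_ne_top _), ← EReal.coe_mul] at h1
  have e : 1 / (n : ℝ) ^ 2 * ((n : ℝ) ^ 2 * c) = c := by field_simp
  rw [e] at h1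
  refine (add_le_add_left h1 _).trans_eq ?_
  simp only [Pi.add_apply]
  rw [add_assoc, add_comm]

theorem freePressure_le_add_norm (h k : FreeProd N R) :
    freePressure h ≤ freePressure k + (‖h - k‖ : ℝ) := by
  refine freePressure_le fun n A => ?_
  have h1 := abs_normTr_le n (evalAt n A (h - k))
  have h2 := norm_evalAt_le n A (h - k)
  rw [evalAt_sub, normTr_sub] at h1
  rw [evalAt_sub] at h2
  have := abs_le.1 (h1.trans h2)
  linarith [this.1]

/-- Hölder's inequality in the form `∫ f^s g^t ≤ (∫ f)^s (∫ g)^t` for `s + t = 1`. -/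
theorem log_lintegral_exp_convex (n : ℕ+) (h k : FreeProd N R) {s t : ℝ} (hs : 0 ≤ s) (ht : 0 ≤ t)
    (hst : s + t = 1) :
    ENNReal.log (∫⁻ A : MatBall N R n, ENNReal.ofReal (Real.exp
        (-((n : ℝ) ^ 2 * normTr n (evalAt n A ((s : ℂ) • h + (t : ℂ) • k))))) ∂ballMeasure N R n) ≤
      s * ENNReal.log (∫⁻ A : MatBall N R n,
        ENNReal.ofReal (Real.exp (-((n : ℝ) ^ 2 * normTr n (evalAt n A h)))) ∂ballMeasure N R n) +
      t * ENNReal.log (∫⁻ A : MatBall N R n,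
        ENNReal.ofReal (Real.exp (-((n : ℝ) ^ 2 * normTr n (evalAt n A k)))) ∂ballMeasure N R n) := by
  have hmeas (x : FreeProd N R) : AEMeasurable (fun A : MatBall N R n =>
      ENNReal.ofReal (Real.exp (-((n : ℝ) ^ 2 * normTr n (evalAt n A x))))) (ballMeasure N R n) :=
    (((measurable_normTr_evalAt n x).const_mul _).neg.exp.ennreal_ofReal).aemeasurable
  rw [← ENNReal.log_rpow, ← ENNReal.log_rpow, ← ENNReal.log_mul_add]
  refine ENNReal.log_monotone (le_trans (lintegral_mono fun A => ?_)
    (ENNReal.lintegral_mul_norm_pow_le (hmeas h) (hmeas k) hs ht hst))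
  rw [ENNReal.ofReal_rpow_of_pos (Real.exp_pos _), ENNReal.ofReal_rpow_of_pos (Real.exp_pos _),
    ← ENNReal.ofReal_mul (Real.rpow_nonneg (Real.exp_pos _).le _), ← Real.exp_mul, ← Real.exp_mul,
    ← Real.exp_add, evalAt_add, evalAt_smul, evalAt_smul, normTr_add, normTr_ofReal_smul,
    normTr_ofReal_smul]
  refine (congrArg _ (congrArg _ ?_)).le
  ring

/-- Convexity at each `n` passes to the upper limit by subadditivity of `limsup`; finiteness at `h`
rules out the indeterminate sum of `⊤` and `⊥`. -/
theorem freePressure_convex {h k : FreeProd N R}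
    (hh : freePressure h ≠ ⊥) (hh' : freePressure h ≠ ⊤)
    {s t : ℝ} (hs : 0 ≤ s) (ht : 0 ≤ t) (hst : s + t = 1) :
    freePressure ((s : ℂ) • h + (t : ℂ) • k) ≤ s * freePressure h + t * freePressure k := by
  have hs' : (0 : EReal) ≤ s := by exact_mod_cast hs
  have ht' : (0 : EReal) ≤ t := by exact_mod_cast ht
  have lh := EReal.limsup_const_mul_of_nonneg_of_ne_top (f := atTop) (u := fun n : ℕ+ =>
    ((1 / (n : ℝ) ^ 2 : ℝ) : EReal) *
        ENNReal.log (∫⁻ A : MatBall N R n,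
          ENNReal.ofReal (Real.exp (-((n : ℝ) ^ 2 * normTr n (evalAt n A h)))) ∂ballMeasure N R n)
      + (((N : ℝ) / 2 * Real.log (n : ℝ) : ℝ) : EReal)) hs' (EReal.coe_ne_top s)
  have lk := EReal.limsup_const_mul_of_nonneg_of_ne_top (f := atTop) (u := fun n : ℕ+ =>
    ((1 / (n : ℝ) ^ 2 : ℝ) : EReal) *
        ENNReal.log (∫⁻ A : MatBall N R n,
          ENNReal.ofReal (Real.exp (-((n : ℝ) ^ 2 * normTr n (evalAt n A k)))) ∂ballMeasure N R n)
      + (((N : ℝ) / 2 * Real.log (n : ℝ) : ℝ) : EReal)) ht' (EReal.coe_ne_top t)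
  rw [← freePressure.eq_def] at lh lk
  have fin {r : ℝ} {x : EReal} (hx : x ≠ ⊥) (hx' : x ≠ ⊤) :
      (r : EReal) * x ≠ ⊥ ∧ (r : EReal) * x ≠ ⊤ := by
    lift x to ℝ using ⟨hx', hx⟩
    rw [← EReal.coe_mul]
    exact ⟨EReal.coe_ne_bot _, EReal.coe_ne_top _⟩
  rw [← lh, ← lk]
  refine le_trans ?_ (EReal.limsup_add_le
    (.inl (by rw [lh]; exact (fin hh hh').1)) (.inl (by rw [lh]; exact (fin hh hh').2)))
  refine limsup_le_limsup (Eventually.of_forall fun n => ?_)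
  have hn2 : (0 : EReal) ≤ ((1 / (n : ℝ) ^ 2 : ℝ) : EReal) := by
    exact_mod_cast (by positivity : (0 : ℝ) ≤ 1 / (n : ℝ) ^ 2)
  have h1 := mul_le_mul_of_nonneg_left (log_lintegral_exp_convex n h k hs ht hst) hn2
  refine (add_le_add_left h1 _).trans_eq ?_
  simp only [Pi.add_apply]
  generalize ENNReal.log _ = x
  generalize ENNReal.log _ = y
  generalize ((N : ℝ) / 2 * Real.log (n : ℝ) : ℝ) = r
  rw [EReal.left_distrib_of_nonneg_of_ne_top hn2 (EReal.coe_ne_top _),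
    EReal.left_distrib_of_nonneg_of_ne_top hs' (EReal.coe_ne_top _),
    EReal.left_distrib_of_nonneg_of_ne_top ht' (EReal.coe_ne_top _)]
  have hr : (r : EReal) = s * r + t * r := by
    rw [← EReal.coe_mul, ← EReal.coe_mul, ← EReal.coe_add, ← add_mul, hst, one_mul]
  conv_lhs => rw [hr]
  rw [mul_left_comm _ (s : EReal), mul_left_comm _ (t : EReal), add_add_add_comm]

/-- The free pressure is `-∞` everywhere, or `+∞` everywhere, or a real-valued function. -/
theorem freePressure_trichotomy (N : ℕ) (R : ℝ) :
    (∀ h : FreeProd N R, freePressure h = ⊥) ∨ (∀ h : FreeProd N R, freePressure h = ⊤) ∨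
      ∃ P : FreeProd N R → ℝ, ∀ h, freePressure h = P h := by
  by_cases hb : ∃ k : FreeProd N R, freePressure k = ⊥
  · obtain ⟨k, hk⟩ := hb
    refine .inl fun h => le_bot_iff.1 ((freePressure_le_add_norm h k).trans ?_)
    simp [hk]
  by_cases ht : ∃ k : FreeProd N R, freePressure k = ⊤
  · obtain ⟨k, hk⟩ := ht
    refine .inr (.inl fun h => ?_)
    by_contra hne
    have := freePressure_le_add_norm k h
    rw [hk, top_le_iff] at this
    exact EReal.add_ne_top hne (EReal.coe_ne_top _) this
  · push Not at hb ht
    exact .inr (.inr ⟨fun h => (freePressure h).toReal,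
      fun h => (EReal.coe_toReal (ht h) (hb h)).symm⟩)

end Pressure

/-! ### Tracial states -/

section TracialStates

variable {N : ℕ} {R : ℝ}

/-- The evaluation at `n = 1`, `A = 0` is a tracial state. -/
theorem tracialStates_nonempty (hR : 0 ≤ R) : (tracialStates N R).Nonempty := by
  let A : MatBall N R (1 : ℕ+) := ⟨0, fun i => by
    change ‖(0 : Matrix (Fin ((1 : ℕ+) : ℕ)) (Fin ((1 : ℕ+) : ℕ)) ℂ)‖ ≤ R
    rwa [norm_zero]⟩
  let f : FreeProd N R →ₗ[ℂ] ℂ :=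
    { toFun := fun h => evalAt 1 A h 0 0
      map_add' := fun _ _ => rfl
      map_smul' := fun _ _ => rfl }
  let g : FreeProd N R →L[ℂ] ℂ := f.mkContinuous 1 fun h => by
    rw [one_mul]
    exact (norm_entry_le_norm _ _ _).trans (norm_evalAt_le 1 A h)
  -- For `1 × 1` matrices the functional is a character, so positivity and traciality are immediate.
  have hmul (a b : FreeProd N R) : g (a * b) = g a * g b := by
    change evalAt 1 A (a * b) 0 0 = evalAt 1 A a 0 0 * evalAt 1 A b 0 0
    rw [evalAt_mul, Matrix.mul_apply]
    exact Fin.sum_univ_one _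
  refine ⟨StrongDual.toWeakDual g, ?_, fun a => ?_, fun a b => ?_⟩
  · change evalAt 1 A 1 0 0 = 1
    rw [evalAt_one, Matrix.one_apply_eq]
  · change 0 ≤ g (star a * a)
    rw [hmul]
    exact star_mul_self_nonneg (evalAt 1 A a 0 0)
  · change g (a * b) = g (b * a)
    rw [hmul, hmul, mul_comm]

theorem convexCombination_mem_tracialStates {μ ν : WeakDual ℂ (FreeProd N R)}
    (hμ : μ ∈ tracialStates N R) (hν : ν ∈ tracialStates N R) {a b : ℝ} (ha : 0 ≤ a) (hb : 0 ≤ b)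
    (hab : a + b = 1) : (a : ℂ) • μ + (b : ℂ) • ν ∈ tracialStates N R := by
  refine ⟨?_, fun x => ?_, fun x y => ?_⟩
  · change (a : ℂ) * μ 1 + (b : ℂ) * ν 1 = 1
    rw [hμ.1, hν.1, mul_one, mul_one, ← Complex.ofReal_add, hab, Complex.ofReal_one]
  · change 0 ≤ (a : ℂ) * μ (star x * x) + (b : ℂ) * ν (star x * x)
    exact add_nonneg (mul_nonneg (Complex.zero_le_real.2 ha) (hμ.2.1 x))
      (mul_nonneg (Complex.zero_le_real.2 hb) (hν.2.1 x))
  · change (a : ℂ) * μ (x * y) + (b : ℂ) * ν (x * y) = (a : ℂ) * μ (y * x) + (b : ℂ) * ν (y * x)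
    rw [hμ.2.2, hν.2.2]

theorem re_convexCombination_apply (μ ν : WeakDual ℂ (FreeProd N R)) (a b : ℝ) (x : FreeProd N R) :
    (((a : ℂ) • μ + (b : ℂ) • ν) x).re = a * (μ x).re + b * (ν x).re := by
  change ((a : ℂ) * μ x + (b : ℂ) * ν x).re = _
  simp

/-- A functional whose real part dominates every common lower bound of the normalized traces of
the evaluations is a tracial state. -/
theorem mem_tracialStates_of_forall_le {μ : WeakDual ℂ (FreeProd N R)}
    (H : ∀ (x : FreeProd N R) (r : ℝ),
      (∀ (n : ℕ+) (A : MatBall N R n), r ≤ normTr n (evalAt n A x)) → r ≤ (μ x).re) :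
    μ ∈ tracialStates N R := by
  -- Applying `H` to both `x` and `-x` turns the inequality into an equality when the trace is
  -- constant.
  have Heq (x : FreeProd N R) (r : ℝ)
      (h : ∀ (n : ℕ+) (A : MatBall N R n), normTr n (evalAt n A x) = r) : (μ x).re = r := by
    refine le_antisymm ?_ (H x r fun n A => (h n A).ge)
    have := H (-x) (-r) fun n A => by
      rw [← h n A, evalAt_neg]
      simp [normTr, neg_div]
    rw [map_neg, Complex.neg_re] at this
    linarith
  -- Complex linearity lets `H`, which only sees real parts, control imaginary parts as well.
  have him (x : FreeProd N R) : (μ x).im = -(μ (Complex.I • x)).re := by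
    rw [map_smul]
    simp
  refine ⟨?_, fun a => ?_, fun a b => ?_⟩
  · apply Complex.ext
    · exact Heq 1 1 fun n A => normTr_one n
    · rw [him, Heq (Complex.I • 1) 0 fun n A => ?_]
      · simp
      · rw [evalAt_smul, evalAt_one]
        simp [normTr]
  · have htr (n : ℕ+) (A : MatBall N R n) : 0 ≤ (evalAt n A (star a * a)).trace :=
      (Matrix.posSemidef_conjTranspose_mul_self (evalAt n A a)).trace_nonneg
    rw [Complex.nonneg_iff]
    refine ⟨H _ 0 fun n A => div_nonneg (Complex.nonneg_iff.1 (htr n A)).1 n.1.cast_nonneg, ?_⟩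
    rw [him, Heq _ 0 fun n A => ?_, neg_zero]
    rw [evalAt_smul, normTr, Matrix.trace_smul]
    simp [← (Complex.nonneg_iff.1 (htr n A)).2]
  · have htr (n : ℕ+) (A : MatBall N R n) : (evalAt n A (a * b - b * a)).trace = 0 := by
      rw [evalAt_sub, evalAt_mul, evalAt_mul, Matrix.trace_sub, Matrix.trace_mul_comm, sub_self]
    rw [← sub_eq_zero, ← map_sub]
    apply Complex.ext
    · exact Heq _ 0 fun n A => by simp [normTr, htr]
    · rw [him, Heq _ 0 fun n A => ?_, neg_zero, Complex.zero_im]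
      rw [evalAt_smul, normTr, Matrix.trace_smul, htr]
      simp

end TracialStates

/-! ### The Legendre transform -/

section Legendre

variable {N : ℕ} {R : ℝ}

theorem eta_le_of_saPoly (μ : WeakDual ℂ (FreeProd N R)) {p : NCPoly N} (hp : p ∈ saPoly N) :
    eta μ ≤ (((μ (ofPoly N R p)).re : ℝ) : EReal) + freePressure (ofPoly N R p) :=
  iInf₂_le p hp

theorem le_eta {μ : WeakDual ℂ (FreeProd N R)} {c : EReal}
    (H : ∀ p ∈ saPoly N,
      c ≤ (((μ (ofPoly N R p)).re : ℝ) : EReal) + freePressure (ofPoly N R p)) : c ≤ eta μ :=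
  le_iInf₂ H

theorem saPoly_zero : (0 : NCPoly N) ∈ saPoly N := polyStar_zero

theorem lipschitz_of_freePressure_eq {P : FreeProd N R → ℝ} (hP : ∀ h, freePressure h = P h) :
    LipschitzWith 1 P := by
  refine LipschitzWith.of_le_add fun h k => ?_
  have := freePressure_le_add_norm h k
  rw [hP, hP] at this
  rw [dist_eq_norm]
  exact_mod_cast this

/-- The infimum defining `eta` over selfadjoint polynomials is dominated by the value at any
selfadjoint element. -/
theorem eta_le {μ : WeakDual ℂ (FreeProd N R)} {h : FreeProd N R} (hh : star h = h) :
    eta μ ≤ (((μ h).re : ℝ) : EReal) + freePressure h := by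
  rcases freePressure_trichotomy N R with hb | ht | ⟨P, hP⟩
  · have := eta_le_of_saPoly μ saPoly_zero
    rw [hb, EReal.add_bot] at this
    exact this.trans bot_le
  · rw [ht, EReal.coe_add_top]
    exact le_top
  · have hcont : Continuous fun x : FreeProd N R => (((μ x).re + P x : ℝ) : EReal) :=
      continuous_coe_real_ereal.comp ((Complex.continuous_re.comp (map_continuous μ)).add
        (lipschitz_of_freePressure_eq hP).continuous)
    -- The inequality is a closed condition, so it extends from selfadjoint polynomials to their
    -- closure.
    have hcl : IsClosed {x : FreeProd N R | eta μ ≤ (((μ x).re + P x : ℝ) : EReal)} :=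
      isClosed_le continuous_const hcont
    rw [hP, ← EReal.coe_add]
    refine closure_minimal ?_ hcl (mem_closure_ofPoly_saPoly hh)
    rintro _ ⟨p, hp, rfl⟩
    have := eta_le_of_saPoly μ hp
    rwa [hP, ← EReal.coe_add] at this

theorem eta_eq_iInf (μ : WeakDual ℂ (FreeProd N R)) :
    eta μ = ⨅ h : selfAdjoint (FreeProd N R),
      (((μ (h : FreeProd N R)).re : ℝ) : EReal) + freePressure (h : FreeProd N R) := by
  refine le_antisymm (le_iInf fun h => eta_le h.2) (le_eta fun p hp => ?_)
  have hsa : ofPoly N R p ∈ selfAdjoint (FreeProd N R) := by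
    rw [selfAdjoint.mem_iff, ← ofPoly_polyStar, hp]
  exact iInf_le (fun h : selfAdjoint (FreeProd N R) =>
    (((μ (h : FreeProd N R)).re : ℝ) : EReal) + freePressure (h : FreeProd N R)) ⟨_, hsa⟩

theorem eta_concave (μ ν : WeakDual ℂ (FreeProd N R)) {a b : ℝ} (ha : 0 ≤ a) (hb : 0 ≤ b)
    (hab : a + b = 1) : a * eta μ + b * eta ν ≤ eta ((a : ℂ) • μ + (b : ℂ) • ν) := by
  have ha' : (0 : EReal) ≤ a := by exact_mod_cast ha
  have hb' : (0 : EReal) ≤ b := by exact_mod_cast hb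
  refine le_eta fun p hp => ?_
  refine (add_le_add (mul_le_mul_of_nonneg_left (eta_le_of_saPoly μ hp) ha')
    (mul_le_mul_of_nonneg_left (eta_le_of_saPoly ν hp) hb')).trans_eq ?_
  generalize freePressure (ofPoly N R p) = x
  rw [re_convexCombination_apply, EReal.left_distrib_of_nonneg_of_ne_top ha' (EReal.coe_ne_top _),
    EReal.left_distrib_of_nonneg_of_ne_top hb' (EReal.coe_ne_top _), add_add_add_comm,
    ← EReal.right_distrib_of_nonneg ha' hb', ← EReal.coe_add a b, hab, EReal.coe_one, one_mul,
    EReal.coe_add, EReal.coe_mul, EReal.coe_mul]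

theorem upperSemicontinuous_eta :
    UpperSemicontinuous (eta : WeakDual ℂ (FreeProd N R) → EReal) := by
  refine upperSemicontinuous_biInf fun p _ => Continuous.upperSemicontinuous ?_
  have hre : Continuous fun μ : WeakDual ℂ (FreeProd N R) => (restrictPoly μ p).re :=
    Complex.continuous_re.comp (WeakDual.eval_continuous (ofPoly N R p))
  generalize freePressure (ofPoly N R p) = x
  induction x with
  | bot => simpa using continuous_const
  | top => simpa using continuous_const
  | coe r =>
    simp only [← EReal.coe_add]
    exact continuous_coe_real_ereal.comp (hre.add continuous_const)

theorem convexOn_of_freePressure_eq {P : FreeProd N R → ℝ} (hP : ∀ h, freePressure h = P h) :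
    ConvexOn ℝ Set.univ P := by
  refine ⟨convex_univ, fun h _ k _ s t hs ht hst => ?_⟩
  have := freePressure_convex (h := h) (k := k) (by simp [hP]) (by simp [hP]) hs ht hst
  simp only [hP, Complex.coe_smul] at this
  simpa using (by exact_mod_cast this :
    P (s • h + t • k) ≤ s * P h + t * P k)

/-- A continuous affine minorant of the free pressure is given by a tracial state. -/
theorem neg_mem_tracialStates_of_le {P : FreeProd N R → ℝ} (hP : ∀ h, freePressure h = P h)
    {l : FreeProd N R →L[ℂ] ℂ} {c : ℝ} (hl : ∀ x, (l x).re + c ≤ P x) :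
    StrongDual.toWeakDual (-l) ∈ tracialStates N R := by
  refine mem_tracialStates_of_forall_le fun x r hx => ?_
  change r ≤ (-(l x)).re
  rw [Complex.neg_re]
  by_contra! hlt
  -- Along the ray `t • x` the pressure is at most `P 0 - t * r`, while the minorant has slope `Re
  -- l(x)`. A positive `Re l(x) + r` would break the minorant for large `t`.
  have hray (t : ℝ) (ht : 0 ≤ t) : t * ((l x).re + r) ≤ P 0 - c := by
    have h1 : freePressure ((t : ℂ) • x) ≤ freePressure (0 : FreeProd N R) + ((-(t * r) : ℝ)) := by
      refine freePressure_le fun n A => ?_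
      have h0 := normTr_ofReal_smul n 0 (evalAt n A x)
      rw [Complex.ofReal_zero, zero_mul, ← evalAt_smul, zero_smul] at h0
      rw [h0, evalAt_smul, normTr_ofReal_smul]
      have := mul_le_mul_of_nonneg_left (hx n A) ht
      linarith
    rw [hP, hP, ← EReal.coe_add, EReal.coe_le_coe_iff] at h1
    have h2 := hl ((t : ℂ) • x)
    rw [map_smul, smul_eq_mul, Complex.re_ofReal_mul] at h2
    linarith
  have hpos : 0 < (l x).re + r := by linarith
  -- `t = 0` gives `P 0 - c ≥ 0`, so the next `t` is admissible; it makes the left side `P 0 - c +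
  -- 1`.
  have h0 := hray 0 le_rfl
  have h1 := hray ((P 0 - c + 1) / ((l x).re + r)) (div_nonneg (by linarith) hpos.le)
  rw [div_mul_cancel₀ _ hpos.ne'] at h1
  linarith

theorem freePressure_eq_iSup (hR : 0 ≤ R) {h : FreeProd N R} (hh : star h = h) :
    freePressure h = ⨆ μ ∈ tracialStates N R, ((-(μ h).re : ℝ) : EReal) + eta μ := by
  refine le_antisymm ?_ (iSup₂_le fun μ _ => ?_)
  · rcases freePressure_trichotomy N R with hb | ht | ⟨P, hP⟩
    · rw [hb]
      exact bot_le
    -- A tracial state has to exist here: an empty supremum would be `⊥`.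
    · obtain ⟨μ, hμ⟩ := tracialStates_nonempty (N := N) hR
      have hη : eta μ = ⊤ := top_le_iff.1 (le_eta fun p _ => by rw [ht, EReal.coe_add_top])
      refine le_iSup₂_of_le μ hμ ?_
      rw [hη, EReal.coe_add_top]
      exact le_top
    · refine le_of_forall_lt fun a ha => ?_
      obtain ⟨b, hab, hbh⟩ := EReal.lt_iff_exists_real_btwn.1 ha
      rw [hP, EReal.coe_lt_coe_iff] at hbh
      -- Hahn–Banach: the point `(h, b)` lies strictly below the graph of a convex lower
      -- semicontinuous function.
      obtain ⟨l, c, hle, heq⟩ := (convexOn_of_freePressure_eq hP).exists_affine_le_of_lt (𝕜 := ℂ)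
        (Set.mem_univ h) hbh isClosed_univ
        ((lipschitz_of_freePressure_eq hP).continuous.lowerSemicontinuous.lowerSemicontinuousOn _)
      have hle' (x : FreeProd N R) : (l x).re + c ≤ P x := hle ⟨x, Set.mem_univ x⟩
      have heq' : (l h).re + c = b := heq
      refine hab.trans_le (le_iSup₂_of_le _ (neg_mem_tracialStates_of_le hP hle') ?_)
      have hc : (c : EReal) ≤ eta (StrongDual.toWeakDual (-l)) := by
        refine le_eta fun p _ => ?_
        rw [hP, ← EReal.coe_add, EReal.coe_le_coe_iff]
        change c ≤ (-(l (ofPoly N R p))).re + _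
        have := hle' (ofPoly N R p)
        rw [Complex.neg_re]
        linarith
      refine le_trans ?_ (add_le_add_right hc _)
      rw [← EReal.coe_add, EReal.coe_le_coe_iff]
      change b ≤ -(-(l h)).re + c
      rw [Complex.neg_re, neg_neg, heq']
  -- Fenchel's inequality: the two terms in `μ h` cancel.
  · refine (add_le_add_right (eta_le hh) _).trans_eq ?_
    rw [← add_assoc, ← EReal.coe_add, neg_add_cancel, EReal.coe_zero, zero_add]

end Legendre

end FreePressure

theorem theorem3p4 (N : ℕ) (R : ℝ) (hR : 0 < R) :
    -- (1) `η_R` is the Legendre transform of `π_R`, concave and weak* upper semicontinuous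
    ((∀ μ ∈ FreePressure.tracialStates N R,
        FreePressure.eta μ =
          ⨅ h : selfAdjoint (FreePressure.FreeProd N R),
            (((μ (h : FreePressure.FreeProd N R)).re : ℝ) : EReal) +
              FreePressure.freePressure (h : FreePressure.FreeProd N R)) ∧
      (∀ μ ∈ FreePressure.tracialStates N R, ∀ ν ∈ FreePressure.tracialStates N R,
        ∀ a b : ℝ, 0 ≤ a → 0 ≤ b → a + b = 1 →
          (a : ℂ) • μ + (b : ℂ) • ν ∈ FreePressure.tracialStates N R ∧
          (a : EReal) * FreePressure.eta μ + (b : EReal) * FreePressure.eta ν ≤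
            FreePressure.eta ((a : ℂ) • μ + (b : ℂ) • ν)) ∧
      UpperSemicontinuousOn (FreePressure.eta (N := N) (R := R))
        (FreePressure.tracialStates N R)) ∧
    -- (2) `π_R` is the Legendre transform of `η_R`
    (∀ h : selfAdjoint (FreePressure.FreeProd N R),
      FreePressure.freePressure (h : FreePressure.FreeProd N R) =
        ⨆ μ ∈ FreePressure.tracialStates N R,
          ((-(μ (h : FreePressure.FreeProd N R)).re : ℝ) : EReal) + FreePressure.eta μ) := by
  exact ⟨⟨fun μ _ => FreePressure.eta_eq_iInf μ,
    fun μ hμ ν hν a b ha hb hab =>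
      ⟨FreePressure.convexCombination_mem_tracialStates hμ hν ha hb hab,
        FreePressure.eta_concave μ ν ha hb hab⟩,
    FreePressure.upperSemicontinuous_eta.upperSemicontinuousOn _⟩,
    fun h => FreePressure.freePressure_eq_iSup hR.le h.2⟩
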